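/- Let $\mathcal K$ be a finite simplicial complex with vertex set $V$ (every $v\in V$ is a vertex of $\mathcal K$, and $\varnothing$ is always a simplex); fix a total order on $V$. For $I\subset V$ let $\mathcal K_I=\{L\in\mathcal K: L\subset I\}$ be the full subcomplex on $I$, and let $\widetilde H^p(\mathcal K_I)$ be its reduced simplicial cohomology with coefficients in $\mathbb Z$ (with $\widetilde H^{-1}(\mathcal K_\varnothing)=\mathbb Z$). The cohomology of the moment-angle complex $\mathcal Z_{\mathcal K}$ is bigraded through the Hochster decomposition $$H^{-k,2\ell}(\mathcal Z_{\mathcal K})=\bigoplus_{I\subset V,\ |I|=\ell}\widetilde H^{\ell-k-1}(\mathcal K_I).$$ For $i\in I$ put $\varepsilon(i,I)=(-1)^{\#\{j\in I\,:\,j<i\}}$ and let $\psi_{p;i,I}\colon\widetilde H^p(\mathcal K_I)\to\widetilde H^p(\mathcal K_{I\setminus\{i\}})$ be induced by the inclusion $\mathcal K_{I\setminus\{i\}}\hookrightarrow\mathcal K_I$. The homomorphisms $d'_p=(-1)^{p+1}\sum_{i\in I}\varepsilon(i,I)\,\psi_{p;i,I}$ on the summands $\widetilde H^p(\mathcal K_I)$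 define a differential $d'\colon H^{-k,2\ell}(\mathcal Z_{\mathcal K})\to H^{-k+1,2\ell-2}(\mathcal Z_{\mathcal K})$ with $(d')^2=0$. The double cohomology $\mathit{HH}^{-k,2\ell}(\mathcal Z_{\mathcal K})$ is the cohomology of $(H^*(\mathcal Z_{\mathcal K}),d')$ in bidegree $(-k,2\ell)$. **Theorem.** Let $\mathcal K=\mathcal K'\cup_\sigma\Delta^n$ be obtained from a simplicial complex $\mathcal K'$ with at least one vertex by gluing an $n$-simplex $\Delta^n$, $n\ge 0$, along a proper, possibly empty, face $\sigma$ of $\Delta^n$ that is also a simplex of $\mathcal K'$; that is, $\mathcal K=\mathcal K'\cup\Delta^n$ and $\mathcal K'\cap\Delta^n$ consists precisely of the faces of $\sigma$. Then either $\mathcal K$ is a simplex (that is, $V\in\mathcal K$), or, for all integers $k,\ell$, $$\mathit{HH}^{-k,2\ell}(\mathcal Z_{\mathcal K})\cong\begin{cases}\mathbb Z & \text{for }(-k,2\ell)=(0,0),\ (-1,4);\\ 0&\text{otherwise.}\end{cases}$$ -/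

import Mathlib

namespace MomentAngle

/-! ## Simplicial complexes

A simplicial complex on (a subset of) `V` is a `PreAbstractSimplicialComplex V`; the empty simplex
is not listed among the `faces` there and is added by hand below, where it is needed.
An `AbstractSimplicialComplex V` has vertex set exactly `V` (no ghost vertices). -/

/-- The simplex with vertex set `τ`: its faces are all nonempty subsets of `τ`.
For `τ = ∅` it is the complex without vertices. -/
def simplex {V : Type*} (τ : Finset V) : PreAbstractSimplicialComplex V where
  faces := {L | L.Nonempty ∧ L ⊆ τ}
  isRelLowerSet_faces := fun _ hL => ⟨hL.1, fun _ hM hM' => ⟨hM', hM.trans hL.2⟩⟩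

/-- The full subcomplex `K_I`: all simplices of `K` contained in `I`. -/
def fullSubcomplex {V : Type*} (K : PreAbstractSimplicialComplex V) (I : Finset V) :
    PreAbstractSimplicialComplex V where
  faces := {L | L ∈ K.faces ∧ L ⊆ I}
  isRelLowerSet_faces := fun _ hL =>
    ⟨(K.isRelLowerSet_faces hL.1).1,
      fun _ hM hM' => ⟨(K.isRelLowerSet_faces hL.1).2 hM hM', hM.trans hL.2⟩⟩

theorem fullSubcomplex_mono {V : Type*} (K : PreAbstractSimplicialComplex V) {I J : Finset V}
    (h : I ⊆ J) : fullSubcomplex K I ≤ fullSubcomplex K J :=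
  fun _ hL => ⟨hL.1, hL.2.trans h⟩

/-- `K = K' ∪_σ Δⁿ`: the complex `K` is the union of `K'` and of the simplex on an
`(n+1)`-element set `τ`, and these two intersect exactly in the simplex on `σ`, which is a proper,
possibly empty, face of `τ`. (The intersection condition makes `σ` a simplex of `K'`.) -/
structure IsGluing {V : Type*} (K K' : PreAbstractSimplicialComplex V) (n : ℕ)
    (σ τ : Finset V) : Prop where
  card_eq : τ.card = n + 1
  proper : σ ⊂ τ
  inter_eq : K' ⊓ simplex τ = simplex σ
  union_eq : K = K' ⊔ simplex τ

/-! ## Reduced simplicial cohomology with integer coefficients -/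

/-- The sign `ε(i, L) = (-1)^{#{j ∈ L : j < i}}`. -/
def ε {V : Type*} [LinearOrder V] (i : V) (L : Finset V) : ℤ :=
  (-1) ^ (L.filter (fun j => j < i)).card

/-- The simplices of `X` of dimension `p`; the empty simplex has dimension `-1`. -/
abbrev Face {V : Type*} (X : PreAbstractSimplicialComplex V) (p : ℤ) : Type _ :=
  {L : Finset V // (L = ∅ ∨ L ∈ X.faces) ∧ (L.card : ℤ) = p + 1}

/-- The face of `M` opposite to its vertex `i`. -/
def Face.erase {V : Type*} [LinearOrder V] {X : PreAbstractSimplicialComplex V} {p q : ℤ}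
    (h : p + 1 = q) (M : Face X q) (i : V) (hi : i ∈ M.1) : Face X p :=
  ⟨M.1.erase i, by
    obtain ⟨M, hM, hc⟩ := M
    refine ⟨?_, ?_⟩
    · rcases Finset.eq_empty_or_nonempty (M.erase i) with he | hne
      · exact Or.inl he
      · refine Or.inr ((X.isRelLowerSet_faces (hM.resolve_left ?_)).2 (M.erase_subset i) hne)
        rintro rfl
        simp at hi
    · have := Finset.card_erase_add_one hi
      simp only at this ⊢
      omega⟩

/-- The group of (augmented) simplicial `p`-cochains of `X`. -/
abbrev Cochain {V : Type*} (X : PreAbstractSimplicialComplex V) (p : ℤ) : Type _ :=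
  Face X p → ℤ

/-- The simplicial coboundary `(d f)(M) = ∑_{i ∈ M} ε(i, M) f(M \ {i})`. -/
def d {V : Type*} [LinearOrder V] (X : PreAbstractSimplicialComplex V) {p q : ℤ} (h : p + 1 = q) :
    Cochain X p →+ Cochain X q where
  toFun f M := ∑ i : M.1, ε i.1 M.1 * f (M.erase h i.1 i.2)
  map_zero' := by
    funext M
    simp
  map_add' f g := by
    funext M
    simp [mul_add, Finset.sum_add_distrib]

/-- The reduced simplicial cohomology group of `X` in degree `p`: cocycles modulo coboundaries. -/
def Cohomology {V : Type*} [LinearOrder V] (X : PreAbstractSimplicialComplex V) (p : ℤ) :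
    Type _ :=
  (d X (rfl : p + 1 = p + 1)).ker ⧸
    (d X (sub_add_cancel p 1)).range.addSubgroupOf (d X (rfl : p + 1 = p + 1)).ker

instance {V : Type*} [LinearOrder V] (X : PreAbstractSimplicialComplex V) (p : ℤ) :
    AddCommGroup (Cohomology X p) :=
  QuotientAddGroup.Quotient.addCommGroup _

/-- Restriction of cochains to a subcomplex. -/
def restrictCochain {V : Type*} {X Y : PreAbstractSimplicialComplex V} (h : X ≤ Y) (p : ℤ) :
    Cochain Y p →+ Cochain X p where
  toFun f L := f ⟨L.1, L.2.1.imp id (fun hL => h hL), L.2.2⟩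
  map_zero' := rfl
  map_add' _ _ := rfl

theorem d_restrictCochain {V : Type*} [LinearOrder V] {X Y : PreAbstractSimplicialComplex V}
    (h : X ≤ Y) {p q : ℤ} (hpq : p + 1 = q) (f : Cochain Y p) :
    d X hpq (restrictCochain h p f) = restrictCochain h q (d Y hpq f) := rfl

/-- The homomorphism of reduced cohomology groups induced by the inclusion of a subcomplex. -/
def cohomologyMap {V : Type*} [LinearOrder V] {X Y : PreAbstractSimplicialComplex V} (h : X ≤ Y)
    (p : ℤ) : Cohomology Y p →+ Cohomology X p :=
  QuotientAddGroup.map _ _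
    (((restrictCochain h p).comp (d Y (rfl : p + 1 = p + 1)).ker.subtype).codRestrict
      (d X (rfl : p + 1 = p + 1)).ker (fun f => by
        rw [AddMonoidHom.mem_ker, AddMonoidHom.comp_apply, d_restrictCochain]
        exact (congrArg (restrictCochain h (p + 1)) f.2).trans (map_zero _)))
    (by
      rintro ⟨_, hf⟩ ⟨g, rfl⟩
      exact ⟨restrictCochain h _ g, rfl⟩)

/-! ## Double cohomology of the moment-angle complex

Through the Hochster decomposition, the bigraded component of bidegree `(-k, 2ℓ)` of the
cohomology of the moment-angle complex of `K` is the sum of the reduced cohomology groups of `K_I`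
in degree `p = ℓ - k - 1` over all `I ⊆ V` with `|I| = ℓ`. -/

/-- The (finite) direct sum of the degree `p` reduced cohomology groups of the full subcomplexes
`K_I` over all `I` with `|I| = ℓ`. -/
abbrev CH {V : Type*} [LinearOrder V] (K : PreAbstractSimplicialComplex V) (p ℓ : ℤ) : Type _ :=
  (I : {I : Finset V // (I.card : ℤ) = ℓ}) → Cohomology (fullSubcomplex K I.1) p

/-- The differential `d'`. Its component from the summand of `I` to the summand of `I \ {i}`, for
`i ∈ I`, is `(-1)^{p+1} ε(i, I)` times the map induced by the inclusion of the full subcomplexes.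
In the formula, `J = I \ {i}`, that is, `I = J ∪ {i}` with `i ∉ J`. -/
def dPrime {V : Type*} [Fintype V] [LinearOrder V] (K : PreAbstractSimplicialComplex V) (p : ℤ)
    {ℓ ℓ' : ℤ} (h : ℓ' + 1 = ℓ) : CH K p ℓ →+ CH K p ℓ' where
  toFun x J :=
    ((p + 1).negOnePow : ℤ) • ∑ i : {i : V // i ∉ J.1},
      ε i.1 (insert i.1 J.1) •
        cohomologyMap (fullSubcomplex_mono K (Finset.subset_insert i.1 J.1)) p
          (x ⟨insert i.1 J.1, by
            rw [Finset.card_insert_of_notMem i.2, Nat.cast_add, J.2, Nat.cast_one, h]⟩)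
  map_zero' := by
    funext J
    simp
  map_add' x y := by
    funext J
    simp [Finset.sum_add_distrib]

/-- The double cohomology group in bidegree `(-k, 2ℓ)`: the cohomology of
`(-k-1, 2ℓ+2) → (-k, 2ℓ) → (-k+1, 2ℓ-2)` with respect to `d'`; note that `p = ℓ - k - 1` is the
same number for the three groups. -/
def HH {V : Type*} [Fintype V] [LinearOrder V] (K : PreAbstractSimplicialComplex V)
    (k ℓ : ℤ) : Type _ :=
  (dPrime K (ℓ - k - 1) (sub_add_cancel ℓ 1)).ker ⧸
    (dPrime K (ℓ - k - 1) (rfl : ℓ + 1 = ℓ + 1)).range.addSubgroupOf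
      (dPrime K (ℓ - k - 1) (sub_add_cancel ℓ 1)).ker

instance {V : Type*} [Fintype V] [LinearOrder V] (K : PreAbstractSimplicialComplex V) (k ℓ : ℤ) :
    AddCommGroup (HH K k ℓ) :=
  QuotientAddGroup.Quotient.addCommGroup _

/-! ## The two differentials square to zero -/

theorem ε_erase {V : Type*} [LinearOrder V] {M : Finset V} {i j : V} (hi : i ∈ M) (hij : i < j) :
    ε j (M.erase i) = -ε j M := by
  have h1 : (M.erase i).filter (fun k => k < j) = (M.filter (fun k => k < j)).erase i := by
    ext a; simp [and_assoc]
  have h2 : i ∈ M.filter (fun k => k < j) := by simp [hi, hij]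
  have h3 := Finset.card_erase_add_one h2
  simp only [ε]
  rw [h1, ← h3, pow_succ]
  ring

theorem ε_erase_of_le {V : Type*} [LinearOrder V] (M : Finset V) {i j : V} (hij : j ≤ i) :
    ε j (M.erase i) = ε j M := by
  have h1 : (M.erase i).filter (fun k => k < j) = M.filter (fun k => k < j) := by
    ext a
    simp only [Finset.mem_filter, Finset.mem_erase]
    exact ⟨fun h => ⟨h.1.2, h.2⟩, fun h => ⟨⟨(h.2.trans_le hij).ne, h.1⟩, h.2⟩⟩
  simp only [ε, h1]

theorem ε_swap {V : Type*} [LinearOrder V] {M : Finset V} {i j : V} (hi : i ∈ M) (hj : j ∈ M)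
    (hij : i ≠ j) :
    ε i M * ε j (M.erase i) + ε j M * ε i (M.erase j) = 0 := by
  rcases lt_or_gt_of_ne hij with h | h
  · rw [ε_erase hi h, ε_erase_of_le M h.le]; ring
  · rw [ε_erase hj h, ε_erase_of_le M h.le]; ring

theorem d_comp_d {V : Type*} [LinearOrder V] (X : PreAbstractSimplicialComplex V) {p q r : ℤ}
    (h : p + 1 = q) (h' : q + 1 = r) : (d X h').comp (d X h) = 0 := by
  refine AddMonoidHom.ext fun f => funext fun M => ?_
  change ∑ i : M.1, ε i.1 M.1 * ∑ j : (M.1.erase i.1 : Finset V),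
    ε j.1 (M.1.erase i.1) *
      f ((M.erase h' i.1 i.2).erase h j.1 j.2) = 0
  simp only [Finset.mul_sum]
  rw [Finset.sum_sigma' Finset.univ (fun _ => Finset.univ)]
  refine Finset.sum_involution
    (fun x _ => ⟨⟨x.2.1, Finset.mem_of_mem_erase x.2.2⟩,
      ⟨x.1.1, Finset.mem_erase.2 ⟨(Finset.ne_of_mem_erase x.2.2).symm, x.1.2⟩⟩⟩)
    ?_ ?_ ?_ ?_
  · rintro ⟨⟨i, hi⟩, ⟨j, hj⟩⟩ -
    have hj' := Finset.mem_of_mem_erase hj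
    have hne : i ≠ j := (Finset.ne_of_mem_erase hj).symm
    have e : (M.erase h' i hi).erase h j hj =
        (M.erase h' j hj').erase h i (Finset.mem_erase.2 ⟨hne, hi⟩) :=
      Subtype.ext (Finset.erase_right_comm)
    simp only [e]
    rw [← mul_assoc, ← mul_assoc, ← add_mul, ε_swap hi hj' hne, zero_mul]
  · rintro ⟨⟨i, hi⟩, ⟨j, hj⟩⟩ - - he
    exact Finset.ne_of_mem_erase hj (congrArg (fun x => x.1.1) he)
  · intros
    exact Finset.mem_univ _
  · intros
    rfl

theorem cohomologyMap_comp {V : Type*} [LinearOrder V] {X Y Z : PreAbstractSimplicialComplex V}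
    (h : X ≤ Y) (h' : Y ≤ Z) (p : ℤ) (x : Cohomology Z p) :
    cohomologyMap h p (cohomologyMap h' p x) = cohomologyMap (h.trans h') p x := by
  obtain ⟨f, rfl⟩ := QuotientAddGroup.mk_surjective x
  rfl

theorem cohomologyMap_congr {V : Type*} [LinearOrder V] (K : PreAbstractSimplicialComplex V)
    (p ℓ : ℤ) (x : CH K p ℓ) (J : Finset V) (I I' : {I : Finset V // (I.card : ℤ) = ℓ})
    (e : I = I') (h : J ⊆ I.1) (h' : J ⊆ I'.1) :
    cohomologyMap (fullSubcomplex_mono K h) p (x I) =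
      cohomologyMap (fullSubcomplex_mono K h') p (x I') := by
  subst e; rfl

theorem dPrime_comp_dPrime {V : Type*} [Fintype V] [LinearOrder V]
    (K : PreAbstractSimplicialComplex V) (p : ℤ) {ℓ ℓ' ℓ'' : ℤ} (h : ℓ' + 1 = ℓ)
    (h' : ℓ'' + 1 = ℓ') : (dPrime K p h').comp (dPrime K p h) = 0 := by
  refine AddMonoidHom.ext fun x => funext fun J => ?_
  simp only [dPrime, AddMonoidHom.coe_mk, ZeroHom.coe_mk, AddMonoidHom.comp_apply, map_zsmul,
    map_sum, AddMonoidHom.zero_apply, Pi.zero_apply, cohomologyMap_comp, Finset.smul_sum, smul_smul]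
  rw [Finset.sum_sigma' Finset.univ (fun _ => Finset.univ)]
  refine Finset.sum_involution
    (fun y _ => ⟨⟨y.2.1, fun hy => y.2.2 (Finset.mem_insert_of_mem hy)⟩,
      ⟨y.1.1, fun hy => (Finset.mem_insert.1 hy).elim
        (fun e => y.2.2 (Finset.mem_insert.2 (Or.inl e.symm))) y.1.2⟩⟩)
    ?_ ?_ ?_ ?_
  · rintro ⟨⟨i, hi⟩, ⟨j, hj⟩⟩ -
    have hji : j ≠ i := fun e => hj (Finset.mem_insert.2 (Or.inl e))
    have hj' : j ∉ J.1 := fun hy => hj (Finset.mem_insert_of_mem hy)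
    have hi' : i ∉ insert j J.1 := by simp [hji.symm, hi]
    have key := cohomologyMap_congr K p ℓ x J.1
      ⟨insert j (insert i J.1), by
        rw [Finset.card_insert_of_notMem hj, Finset.card_insert_of_notMem hi]
        have := J.2
        push_cast
        omega⟩
      ⟨insert i (insert j J.1), by
        rw [Finset.card_insert_of_notMem hi', Finset.card_insert_of_notMem hj']
        have := J.2
        push_cast
        omega⟩
      (Subtype.ext (Finset.insert_comm j i J.1))
      ((Finset.subset_insert _ _).trans (Finset.subset_insert _ _))
      ((Finset.subset_insert _ _).trans (Finset.subset_insert _ _))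
    have e1 : (insert i (insert j J.1)).erase i = insert j J.1 := Finset.erase_insert hi'
    have e2 : (insert i (insert j J.1)).erase j = insert i J.1 := by
      rw [Finset.insert_comm]; exact Finset.erase_insert hj
    have sgn := ε_swap (M := insert i (insert j J.1)) (Finset.mem_insert_self _ _)
      (Finset.mem_insert_of_mem (Finset.mem_insert_self _ _)) hji.symm
    rw [e1, e2] at sgn
    simp only [key]
    rw [← add_smul]
    convert zero_smul ℤ _
    rw [Finset.insert_comm j i J.1]
    linear_combination ((p + 1).negOnePow : ℤ) * ((p + 1).negOnePow : ℤ) * sgn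
  · rintro ⟨⟨i, hi⟩, ⟨j, hj⟩⟩ - - he
    have e : j = i := congrArg (fun y => y.1.1) he
    exact hj (Finset.mem_insert.2 (Or.inl e))
  · intros
    exact Finset.mem_univ _
  · intros
    rfl

end MomentAngle

/-! A vertex `r ∈ τ \ σ` has the simplex `τ` as its star in `K`. Hence the link of `r` in `K_I` is
the simplex on `(I \ {r}) ∩ τ`, and the relative cohomology of `(K_I, K_{I \ {r}})` vanishes unless
this set is empty; then `r` is isolated in `K_I` and only degree 0 survives, spanned by the
indicator of `r`. So in degrees `p ≥ 0` restriction along the deletion of `r` is onto, with this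
explicit kernel.

If `τ ≠ V`, take `w ∉ τ`. Surjectivity lets one subtract a `d'`-boundary from a `d'`-cocycle so that
nothing is left on sets missing `r`; the cocycle condition then makes each component die on deletion
of `r`. Such components are multiples of the indicator of `r`, and these extend over `w`, so the
same normalization works for `w` without spoiling that for `r` (`IsStar.exists_normalized`). A
component dying on both deletions lives on `I ∋ r, w` with `p = 0`. If `I` has a third vertex, the
indicator of `r` stays nonzero after deleting `w`, so the component is zero. Only `I = {r, w}`
remains, giving bidegree `(-1, 4)`. In negative degrees only `I = ∅` contributes, giving `(0, 0)`.
-/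

namespace MomentAngle

/-! ## Cochains given by functions on finite sets -/

/-- The cochain whose value on a face `M` is `F M`. -/
def ofFun {V : Type*} (X : PreAbstractSimplicialComplex V) (p : ℤ) (F : Finset V → ℤ) :
    Cochain X p :=
  fun M => F M.1

theorem exists_eq_ofFun {V : Type*} {X : PreAbstractSimplicialComplex V} {p : ℤ}
    (f : Cochain X p) :
    ∃ F : Finset V → ℤ, f = ofFun X p F ∧ ∀ L, L ∉ X.faces → L ≠ ∅ → F L = 0 := by
  classical
  refine ⟨fun L => if h : (L = ∅ ∨ L ∈ X.faces) ∧ (L.card : ℤ) = p + 1 then f ⟨L, h⟩ else 0,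
    funext fun M => ?_, fun L h h' => ?_⟩
  · simp only [ofFun]
    rw [dif_pos M.2]
  · exact dif_neg fun hL => hL.1.elim h' h

theorem d_ofFun {V : Type*} [LinearOrder V] (X : PreAbstractSimplicialComplex V) {p q : ℤ}
    (h : p + 1 = q) (F : Finset V → ℤ) (M : Face X q) :
    d X h (ofFun X p F) M = ∑ i ∈ M.1, ε i M.1 * F (M.1.erase i) :=
  Finset.sum_coe_sort M.1 fun i => ε i M.1 * F (M.1.erase i)

theorem d_apply_of_singleton {V : Type*} [LinearOrder V] (X : PreAbstractSimplicialComplex V)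
    {p q : ℤ} (h : p + 1 = q) (F : Finset V → ℤ) (M : Face X q) {v : V} (hM : M.1 = {v}) :
    d X h (ofFun X p F) M = F ∅ := by
  rw [d_ofFun, hM]
  simp [ε, Finset.filter_singleton]

theorem ε_mul_self {V : Type*} [LinearOrder V] (i : V) (L : Finset V) : ε i L * ε i L = 1 := by
  rw [ε, ← mul_pow]
  simp

/-- The sign rule by which coning off at `t` anticommutes with deleting `i`. -/
theorem ε_insert_mul {V : Type*} [LinearOrder V] {M : Finset V} {i t : V} (ht : t ∉ M)
    (hi : i ∈ M) :
    ε i M * ε t (insert t (M.erase i)) = -(ε t (insert t M) * ε i (insert t M)) := by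
  have hne : i ≠ t := fun e => ht (e ▸ hi)
  have h := ε_swap (M := insert t M) (Finset.mem_insert_of_mem hi) (Finset.mem_insert_self t M) hne
  rw [Finset.erase_insert ht, Finset.erase_insert_of_ne hne.symm] at h
  have h1 := ε_mul_self t (insert t M)
  have h2 := ε_mul_self t (insert t (M.erase i))
  linear_combination (ε t (insert t M) * ε t (insert t (M.erase i))) * h
    - ε i M * ε t (insert t (M.erase i)) * h1 - ε t (insert t M) * ε i (insert t M) * h2

/-- If `t` can be added to every face containing `r`, then each cocycle supported on the faces
containing `r` is the coboundary of a cochain supported on these faces. -/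
theorem exists_d_eq_of_cone {V : Type*} [LinearOrder V] {X : PreAbstractSimplicialComplex V}
    {r t : V} (htr : t ≠ r) (hX : ∀ M ∈ X.faces, r ∈ M → insert t M ∈ X.faces) {p q : ℤ}
    (h : p + 1 = q) (u : Cochain X q) (hu : d X (rfl : q + 1 = q + 1) u = 0)
    (hr : ∀ M : Face X q, r ∉ M.1 → u M = 0) :
    ∃ f : Cochain X p, d X h f = u ∧ ∀ M : Face X p, r ∉ M.1 → f M = 0 := by
  classical
  obtain ⟨U, rfl, -⟩ := exists_eq_ofFun u
  -- The contracting homotopy of a cone with apex `t`, cut down to the faces containing `r`.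
  set F : Finset V → ℤ := fun M =>
    if r ∈ M ∧ t ∉ M then ε t (insert t M) * U (insert t M) else 0 with hF
  refine ⟨ofFun X p F, funext fun M => ?_, fun M hM => if_neg fun h' => hM h'.1⟩
  rw [d_ofFun]
  change _ = U M.1
  by_cases hrM : r ∈ M.1
  swap
  · refine (Finset.sum_eq_zero fun i _ => ?_).trans (hr M hrM).symm
    rw [hF]
    simp only
    rw [if_neg fun h' => hrM (Finset.mem_of_mem_erase h'.1), mul_zero]
  by_cases htM : t ∈ M.1
  · rw [Finset.sum_eq_single_of_mem t htM fun i _ hit => ?_]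
    · rw [hF]
      simp only
      rw [if_pos ⟨Finset.mem_erase.2 ⟨htr.symm, hrM⟩, Finset.notMem_erase t M.1⟩,
        Finset.insert_erase htM, ← mul_assoc, ε_mul_self, one_mul]
    · rw [hF]
      simp only
      rw [if_neg fun h' => h'.2 (Finset.mem_erase.2 ⟨hit.symm, htM⟩), mul_zero]
  -- For `t ∉ M`, the value of `U` at `M` is recovered from the cocycle condition on `insert t M`.
  · have hMX : M.1 ∈ X.faces := M.2.1.resolve_left fun e => by simp [e] at hrM
    have hcard : ((insert t M.1).card : ℤ) = q + 1 + 1 := by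
      rw [Finset.card_insert_of_notMem htM, Nat.cast_add, M.2.2, Nat.cast_one]
    have key := congrFun hu ⟨insert t M.1, Or.inr (hX _ hMX hrM), hcard⟩
    rw [d_ofFun] at key
    simp only [Pi.zero_apply] at key
    rw [Finset.sum_insert htM, Finset.erase_insert htM] at key
    have e : ∀ i ∈ M.1, ε i M.1 * F (M.1.erase i) =
        -(ε t (insert t M.1) * (ε i (insert t M.1) * U ((insert t M.1).erase i))) := by
      intro i hi
      have hti : t ≠ i := fun e => htM (e ▸ hi)
      rw [Finset.erase_insert_of_ne hti]
      -- Deleting `r` leaves the range of `F`; the matching term of the cocycle condition vanishes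
      -- by the support of `U`.
      by_cases hir : r = i
      · subst hir
        have h0 : U (insert t (M.1.erase r)) = 0 := by
          refine hr ⟨insert t (M.1.erase r), Or.inr ?_, ?_⟩ ?_
          · refine (X.isRelLowerSet_faces (hX _ hMX hrM)).2
              (Finset.insert_subset_insert _ (Finset.erase_subset _ _)) (Finset.insert_nonempty _ _)
          · rw [Finset.card_insert_of_notMem (fun h' => htM (Finset.mem_of_mem_erase h')),
              Finset.card_erase_add_one hi, M.2.2]
          · simp [htr.symm]
        rw [h0, hF]
        simp
      · rw [hF]
        simp only
        rw [if_pos ⟨Finset.mem_erase.2 ⟨hir, hrM⟩, fun h' => htM (Finset.mem_of_mem_erase h')⟩,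
          ← mul_assoc, ε_insert_mul htM hi]
        ring
    rw [Finset.sum_congr rfl e, Finset.sum_neg_distrib, ← Finset.mul_sum]
    linear_combination (-ε t (insert t M.1)) * key + U M.1 * ε_mul_self t (insert t M.1)

/-! ## Cohomology classes -/

/-- The cohomology class of a cocycle. -/
def cohomologyClass {V : Type*} [LinearOrder V] {X : PreAbstractSimplicialComplex V} {p : ℤ}
    (f : Cochain X p) (hf : d X (rfl : p + 1 = p + 1) f = 0) : Cohomology X p :=
  QuotientAddGroup.mk ⟨f, hf⟩

theorem exists_eq_cohomologyClass {V : Type*} [LinearOrder V]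
    {X : PreAbstractSimplicialComplex V} {p : ℤ} (x : Cohomology X p) :
    ∃ f hf, x = cohomologyClass f hf := by
  obtain ⟨f, rfl⟩ := QuotientAddGroup.mk_surjective x
  exact ⟨f.1, f.2, rfl⟩

theorem cohomologyClass_eq_zero_iff {V : Type*} [LinearOrder V]
    {X : PreAbstractSimplicialComplex V} {p : ℤ} (f : Cochain X p)
    (hf : d X (rfl : p + 1 = p + 1) f = 0) :
    cohomologyClass f hf = 0 ↔ ∃ g, d X (sub_add_cancel p 1) g = f :=
  (QuotientAddGroup.eq_zero_iff _).trans AddSubgroup.mem_addSubgroupOf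

theorem cohomologyClass_eq_of_sub_eq_d {V : Type*} [LinearOrder V]
    {X : PreAbstractSimplicialComplex V} {p : ℤ} {f f' : Cochain X p}
    (hf : d X (rfl : p + 1 = p + 1) f = 0) (hf' : d X (rfl : p + 1 = p + 1) f' = 0)
    (g : Cochain X (p - 1)) (h : d X (sub_add_cancel p 1) g = f - f') :
    cohomologyClass f hf = cohomologyClass f' hf' := by
  rw [← sub_eq_zero]
  exact (cohomologyClass_eq_zero_iff (f - f') (by rw [map_sub, hf, hf', sub_zero])).2 ⟨g, h⟩

theorem cohomologyMap_cohomologyClass {V : Type*} [LinearOrder V]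
    {X Y : PreAbstractSimplicialComplex V} (h : X ≤ Y) {p : ℤ} (f : Cochain Y p)
    (hf : d Y (rfl : p + 1 = p + 1) f = 0) :
    cohomologyMap h p (cohomologyClass f hf) =
      cohomologyClass (restrictCochain h p f)
        (by rw [d_restrictCochain, hf, map_zero]) :=
  rfl

/-! ## Deleting a vertex whose star is a simplex -/

/-- The vertex `r` of `τ` has star `simplex τ` in `K`, and every `v : V` is a vertex of `K`. -/
structure IsStar {V : Type*} (K : PreAbstractSimplicialComplex V) (r : V) (τ : Finset V) :
    Prop where
  mem : r ∈ τ
  subset : ∀ L ∈ K.faces, r ∈ L → L ⊆ τ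
  mem_faces : ∀ L : Finset V, L.Nonempty → L ⊆ τ → L ∈ K.faces
  singleton : ∀ v, {v} ∈ K.faces

/-- Cochains supported on faces containing `r` are the relative cochains of `(K_I, K_{I \ {r}})`.
Any `t ∈ (I \ {r}) ∩ τ` is a cone apex for these faces; without such `t` the only possible face is
`{r}`, of dimension 0. -/
theorem IsStar.exists_d_eq {V : Type*} [LinearOrder V] {K : PreAbstractSimplicialComplex V}
    {r : V} {τ : Finset V} (hK : IsStar K r τ) {I : Finset V} {p q : ℤ} (h : p + 1 = q)
    (hI : q ≠ 0 ∨ ¬ Disjoint (I.erase r) τ) (u : Cochain (fullSubcomplex K I) q)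
    (hu : d _ (rfl : q + 1 = q + 1) u = 0)
    (hr : ∀ M : Face (fullSubcomplex K I) q, r ∉ M.1 → u M = 0) :
    ∃ f : Cochain (fullSubcomplex K I) p,
      d _ h f = u ∧ ∀ M : Face (fullSubcomplex K I) p, r ∉ M.1 → f M = 0 := by
  by_cases hd : Disjoint (I.erase r) τ
  · refine ⟨0, ?_, fun _ _ => rfl⟩
    rw [map_zero]
    refine (funext fun M => ?_).symm
    by_cases hM : r ∈ M.1
    · have hMf := M.2.1.resolve_left fun e => by simp [e] at hM
      have : M.1 ⊆ {r} := fun i hi => by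
        by_contra hir
        exact Finset.disjoint_left.1 hd (Finset.mem_erase.2 ⟨by simpa using hir, hMf.2 hi⟩)
          (hK.subset _ hMf.1 hM hi)
      have hMr : M.1 = {r} := this.antisymm (by simpa using hM)
      have hc := M.2.2
      rw [hMr] at hc
      simp only [Finset.card_singleton, Nat.cast_one] at hc
      exact absurd (by omega) (hI.resolve_right (not_not.2 hd))
    · exact hr M hM
  · obtain ⟨t, ht, htτ⟩ := Finset.not_disjoint_iff.1 hd
    refine exists_d_eq_of_cone (X := fullSubcomplex K I) (Finset.ne_of_mem_erase ht)
      (fun M hM hrM => And.intro ?_ ?_) h u hu hr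
    · exact hK.mem_faces _ (Finset.insert_nonempty _ _)
        (Finset.insert_subset htτ (hK.subset _ hM.1 hrM))
    · exact Finset.insert_subset (Finset.mem_of_mem_erase ht) hM.2

/-- The obstruction to extending a cocycle is a relative class of degree `p + 1`, which is nonzero
as a degree because `p ≥ 0`. -/
theorem IsStar.cohomologyMap_surjective {V : Type*} [LinearOrder V]
    {K : PreAbstractSimplicialComplex V} {r : V} {τ : Finset V} (hK : IsStar K r τ)
    {I J : Finset V} (hIJ : insert r I = J) (hr : r ∉ I) {p : ℤ} (hp : 0 ≤ p) (h : I ⊆ J) :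
    Function.Surjective (cohomologyMap (fullSubcomplex_mono K h) p) := by
  subst hIJ
  intro x
  obtain ⟨f, hf, rfl⟩ := exists_eq_cohomologyClass x
  obtain ⟨F, rfl, -⟩ := exists_eq_ofFun f
  obtain ⟨f', hf', hf'r⟩ := hK.exists_d_eq (I := insert r I) (rfl : p + 1 = p + 1)
    (Or.inl (by omega)) (d _ rfl (ofFun _ p F)) (DFunLike.congr_fun (d_comp_d _ _ _) _)
    (fun M hM => congrFun hf ⟨M.1, M.2.1.imp id fun h' => ⟨h'.1,
      (Finset.subset_insert_iff_of_notMem hM).1 h'.2⟩, M.2.2⟩)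
  refine ⟨cohomologyClass (ofFun _ p F - f') (by rw [map_sub, hf', sub_self]), ?_⟩
  rw [cohomologyMap_cohomologyClass]
  congr 1
  funext M
  refine (congrArg (F M.1 - ·) (hf'r ⟨M.1, _⟩ fun hM => ?_)).trans (sub_zero _)
  rcases M.2.1 with e | h'
  · simp [e] at hM
  · exact hr (h'.2 hM)

theorem IsStar.eq_zero_or {V : Type*} [LinearOrder V]
    {K : PreAbstractSimplicialComplex V} {r : V} {τ : Finset V} (hK : IsStar K r τ)
    {I : Finset V} {p : ℤ} (h : I.erase r ⊆ I) (x : Cohomology (fullSubcomplex K I) p)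
    (hx : cohomologyMap (fullSubcomplex_mono K h) p x = 0) :
    x = 0 ∨ p = 0 ∧ Disjoint (I.erase r) τ ∧
      ∃ c hc, x = cohomologyClass (ofFun _ p fun M => if M = {r} then c else 0) hc := by
  obtain ⟨f, hf, rfl⟩ := exists_eq_cohomologyClass x
  rw [cohomologyMap_cohomologyClass, cohomologyClass_eq_zero_iff] at hx
  obtain ⟨g, hg⟩ := hx
  obtain ⟨G, rfl, -⟩ := exists_eq_ofFun g
  -- `G` extends the primitive `g` to `K_I`, so `u` is a cohomologous cocycle vanishing on faces
  -- without `r`.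
  set u := f - d _ (sub_add_cancel p 1) (ofFun _ (p - 1) G) with hu
  have hu0 : d _ (rfl : p + 1 = p + 1) u = 0 := by
    rw [hu, map_sub, hf, zero_sub, neg_eq_zero]
    exact DFunLike.congr_fun (d_comp_d _ _ _) _
  have hur : ∀ M : Face (fullSubcomplex K I) p, r ∉ M.1 → u M = 0 := fun M hM =>
    sub_eq_zero.2 (congrFun hg ⟨M.1, M.2.1.imp id fun h' => ⟨h'.1, fun i hi =>
      Finset.mem_erase.2 ⟨fun e => hM (e ▸ hi), h'.2 hi⟩⟩, M.2.2⟩).symm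
  rw [cohomologyClass_eq_of_sub_eq_d hf hu0 (ofFun _ (p - 1) G) (by rw [hu, sub_sub_cancel])]
  by_cases hI : p ≠ 0 ∨ ¬ Disjoint (I.erase r) τ
  · left
    obtain ⟨f', hf', -⟩ := hK.exists_d_eq (sub_add_cancel p 1) hI u hu0 hur
    exact (cohomologyClass_eq_zero_iff _ _).2 ⟨f', hf'⟩
  · rw [not_or, not_not, not_not] at hI
    refine Or.inr ⟨hI.1, hI.2, ?_⟩
    obtain ⟨U, hU, hU0⟩ := exists_eq_ofFun u
    have key : u = ofFun _ p fun M => if M = {r} then U {r} else 0 := by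
      funext M
      change _ = if M.1 = {r} then U {r} else 0
      split_ifs with hM
      · rw [hU, ← hM]
        rfl
      · refine hur M fun hrM => hM ?_
        have hc := M.2.2
        obtain ⟨a, ha⟩ := Finset.card_eq_one.1 (by omega : M.1.card = 1)
        rw [ha, Finset.mem_singleton] at hrM
        rw [ha, hrM]
    exact ⟨U {r}, key ▸ hu0, by congr 1⟩

theorem IsStar.d_single_eq_zero {V : Type*} [LinearOrder V]
    {K : PreAbstractSimplicialComplex V} {r : V} {τ : Finset V} (hK : IsStar K r τ)
    {I : Finset V} (hI : Disjoint (I.erase r) τ) {p q : ℤ} (h : p + 1 = q) (c : ℤ) :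
    d (fullSubcomplex K I) h (ofFun _ p fun M => if M = {r} then c else 0) = 0 := by
  funext M
  rw [d_ofFun]
  refine Finset.sum_eq_zero fun i hi => ?_
  rw [if_neg fun e => ?_, mul_zero]
  have hrM : r ∈ M.1 := Finset.mem_of_mem_erase (e ▸ Finset.mem_singleton_self r)
  have hMf := M.2.1.resolve_left fun e => by simp [e] at hrM
  have hir : i ≠ r := by
    rintro rfl
    exact Finset.notMem_erase i M.1 (e ▸ Finset.mem_singleton_self i)
  exact Finset.disjoint_left.1 hI (Finset.mem_erase.2 ⟨hir, hMf.2 hi⟩)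
    (hK.subset _ hMf.1 hrM hi)

theorem restrictCochain_single_eq_zero {V : Type*} [LinearOrder V]
    (K : PreAbstractSimplicialComplex V) (r : V) {I J : Finset V} (h : I ⊆ J) (hr : r ∉ I)
    (p c : ℤ) :
    restrictCochain (fullSubcomplex_mono K h) p (ofFun _ p fun M => if M = {r} then c else 0) =
      0 := by
  funext M
  refine if_neg fun e => ?_
  rcases M.2.1 with h' | h'
  · simp [h'] at e
  · exact hr (h'.2 (e ▸ Finset.mem_singleton_self r))

/-- Since `w ∉ τ`, adding `w` creates no new neighbour of `r`, so the indicator of `r` is still a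
cocycle and still dies when `r` is deleted. -/
theorem IsStar.exists_lift {V : Type*} [LinearOrder V]
    {K : PreAbstractSimplicialComplex V} {r w : V} {τ : Finset V} (hK : IsStar K r τ)
    (hw : w ∉ τ) {I J : Finset V} (hIJ : insert w I = J) {p : ℤ}
    (h : I ⊆ J) (x : Cohomology (fullSubcomplex K I) p)
    (hx : cohomologyMap (fullSubcomplex_mono K (I.erase_subset r)) p x = 0) :
    ∃ y : Cohomology (fullSubcomplex K J) p, cohomologyMap (fullSubcomplex_mono K h) p y = x ∧
      cohomologyMap (fullSubcomplex_mono K (J.erase_subset r)) p y = 0 := by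
  rcases hK.eq_zero_or (I.erase_subset r) x hx with rfl | ⟨rfl, hI, c, hc, rfl⟩
  · exact ⟨0, map_zero _, map_zero _⟩
  · have hJ : Disjoint (J.erase r) τ := by
      subst hIJ
      rw [Finset.disjoint_left] at hI ⊢
      intro a ha haτ
      rw [Finset.mem_erase, Finset.mem_insert] at ha
      rcases ha.2 with rfl | haI
      · exact hw haτ
      · exact hI (Finset.mem_erase.2 ⟨ha.1, haI⟩) haτ
    refine ⟨cohomologyClass _ (hK.d_single_eq_zero hJ rfl c), rfl, ?_⟩
    rw [cohomologyMap_cohomologyClass, cohomologyClass_eq_zero_iff]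
    exact ⟨0, (map_zero _).trans (restrictCochain_single_eq_zero K r (J.erase_subset r)
      (Finset.notMem_erase r J) 0 c).symm⟩

/-- Coboundaries in reduced degree 0 are constant functions; compare the values at `r` and `v`. -/
theorem IsStar.eq_zero_of_single_eq_zero {V : Type*} [LinearOrder V]
    {K : PreAbstractSimplicialComplex V} {r : V} {τ : Finset V} (hK : IsStar K r τ)
    {I : Finset V} {v : V} (hr : r ∈ I) (hv : v ∈ I) (hvr : v ≠ r) {c : ℤ}
    (hc : d (fullSubcomplex K I) (rfl : (0 : ℤ) + 1 = 0 + 1)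
      (ofFun _ 0 fun M => if M = {r} then c else 0) = 0)
    (h : cohomologyClass _ hc = 0) : c = 0 := by
  obtain ⟨g, hg⟩ := (cohomologyClass_eq_zero_iff _ _).1 h
  obtain ⟨G, rfl, -⟩ := exists_eq_ofFun g
  have key : ∀ a ∈ I, G ∅ = if ({a} : Finset V) = {r} then c else 0 := fun a ha => by
    have := congrFun hg ⟨{a}, Or.inr ⟨hK.singleton a, by simpa using ha⟩, by simp⟩
    rwa [d_apply_of_singleton _ _ _ _ rfl] at this
  have h1 := key r hr
  have h2 := key v hv
  rw [if_pos rfl] at h1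
  rw [if_neg (by simpa using hvr)] at h2
  exact h1.symm.trans h2

theorem IsStar.eq_zero {V : Type*} [LinearOrder V]
    {K : PreAbstractSimplicialComplex V} {r w : V} {τ : Finset V} (hK : IsStar K r τ)
    (hwr : w ≠ r) {I : Finset V} (hr : r ∈ I) {p : ℤ} (hI : p ≠ 0 ∨ 3 ≤ I.card)
    (x : Cohomology (fullSubcomplex K I) p)
    (hx : cohomologyMap (fullSubcomplex_mono K (I.erase_subset r)) p x = 0)
    (hxw : cohomologyMap (fullSubcomplex_mono K (I.erase_subset w)) p x = 0) : x = 0 := by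
  rcases hK.eq_zero_or (I.erase_subset r) x hx with rfl | ⟨rfl, -, c, hc, rfl⟩
  · rfl
  -- A third vertex detects the indicator of `r` on `I \ {w}`.
  · obtain ⟨v, hv⟩ : ((I.erase w).erase r).Nonempty := by
      rw [← Finset.card_pos]
      have h1 := Finset.pred_card_le_card_erase (s := I) (a := w)
      have h2 := Finset.pred_card_le_card_erase (s := I.erase w) (a := r)
      have := hI.resolve_left (not_not.2 rfl)
      omega
    rw [Finset.mem_erase] at hv
    have : c = 0 := hK.eq_zero_of_single_eq_zero (Finset.mem_erase.2 ⟨hwr.symm, hr⟩) hv.2 hv.1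
      _ hxw
    subst this
    exact (cohomologyClass_eq_zero_iff _ _).2 ⟨0, (map_zero _).trans (funext fun M => by
      simp [ofFun])⟩

/-! ## Normalization of elements of the double complex -/

theorem eq_zero_of_cohomologyMap_erase_of_notMem {V : Type*} [LinearOrder V]
    (K : PreAbstractSimplicialComplex V) {v : V} {I : Finset V} (hv : v ∉ I) {p : ℤ}
    (x : Cohomology (fullSubcomplex K I) p)
    (hx : cohomologyMap (fullSubcomplex_mono K (I.erase_subset v)) p x = 0) : x = 0 := by
  have h : I ⊆ I.erase v := (Finset.erase_eq_of_notMem hv).ge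
  have key := cohomologyMap_comp (fullSubcomplex_mono K h)
    (fullSubcomplex_mono K (I.erase_subset v)) p x
  rw [hx, map_zero] at key
  obtain ⟨f, hf, rfl⟩ := exists_eq_cohomologyClass x
  exact key.symm

theorem sign_mul_self {V : Type*} [LinearOrder V] (p : ℤ) (v : V) (L : Finset V) :
    ((p.negOnePow : ℤ) * ε v L) * ((p.negOnePow : ℤ) * ε v L) = 1 := by
  have h1 : (p.negOnePow : ℤ) * p.negOnePow = 1 := by
    rw [← Units.val_mul, Int.units_mul_self, Units.val_one]
  linear_combination ε v L * ε v L * h1 + ε_mul_self v L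

theorem cohomologyMap_erase_cohomologyMap {V : Type*} [LinearOrder V]
    (K : PreAbstractSimplicialComplex V) {I J : Finset V} (v : V) (h : J ⊆ I) {p : ℤ}
    (x : Cohomology (fullSubcomplex K I) p)
    (hx : cohomologyMap (fullSubcomplex_mono K (I.erase_subset v)) p x = 0) :
    cohomologyMap (fullSubcomplex_mono K (J.erase_subset v)) p
      (cohomologyMap (fullSubcomplex_mono K h) p x) = 0 := by
  rw [cohomologyMap_comp, ← cohomologyMap_comp
    (fullSubcomplex_mono K (Finset.erase_subset_erase v h))
    (fullSubcomplex_mono K (I.erase_subset v)), hx, map_zero]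

theorem IsStar.eq_zero_of_normalized {V : Type*} [LinearOrder V]
    {K : PreAbstractSimplicialComplex V} {r w : V} {τ : Finset V} (hK : IsStar K r τ) (hw : w ∉ τ)
    {p ℓ : ℤ} (hℓ : p ≠ 0 ∨ ℓ ≠ 2) (x : CH K p ℓ) (hx : ∀ I,
      cohomologyMap (fullSubcomplex_mono K (I.1.erase_subset r)) p (x I) = 0 ∧
      cohomologyMap (fullSubcomplex_mono K (I.1.erase_subset w)) p (x I) = 0) : x = 0 := by
  have hwr : w ≠ r := fun e => hw (e ▸ hK.mem)
  funext I
  by_cases hr : r ∈ I.1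
  swap
  · exact eq_zero_of_cohomologyMap_erase_of_notMem K hr _ (hx I).1
  by_cases hwI : w ∈ I.1
  swap
  · exact eq_zero_of_cohomologyMap_erase_of_notMem K hwI _ (hx I).2
  refine hK.eq_zero hwr hr (hℓ.imp id fun h2 => ?_) (x I) (hx I).1 (hx I).2
  have h1 : 1 < I.1.card := Finset.one_lt_card.2 ⟨w, hwI, r, hr, hwr⟩
  have := I.2
  omega

/-! ### The component of `d'` along one vertex, and normalization -/

section

variable {V : Type*} [Fintype V] [LinearOrder V] (K : PreAbstractSimplicialComplex V) {p : ℤ}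

theorem dPrime_apply_of_support {ℓ ℓ' : ℤ} (h : ℓ' + 1 = ℓ) {v : V} (x : CH K p ℓ)
    (hx : ∀ I, v ∉ I.1 → x I = 0) (I : {I : Finset V // (I.card : ℤ) = ℓ})
    (J : {J : Finset V // (J.card : ℤ) = ℓ'}) (hJ : v ∉ J.1) (hIJ : insert v J.1 = I.1) :
    dPrime K p h x J = ((p + 1).negOnePow : ℤ) • ε v I.1 •
      cohomologyMap (fullSubcomplex_mono K (hIJ ▸ Finset.subset_insert v J.1)) p (x I) := by
  have hc : ((insert v J.1).card : ℤ) = ℓ := hIJ ▸ I.2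
  obtain rfl : I = ⟨insert v J.1, hc⟩ := Subtype.ext hIJ.symm
  have e : dPrime K p h x J = ((p + 1).negOnePow : ℤ) • ∑ i : {i : V // i ∉ J.1}, _ := rfl
  rw [e, Finset.sum_eq_single_of_mem ⟨v, hJ⟩ (Finset.mem_univ _)]
  rintro ⟨i, hi⟩ - hiv
  rw [hx, map_zero, smul_zero]
  rw [Finset.mem_insert, not_or]
  exact ⟨fun e => hiv (Subtype.ext e.symm), hJ⟩

/-- At `I \ {v}` the support condition leaves only the `v`-term of `d'`, which is a restriction up
to an invertible sign. -/
theorem cohomologyMap_erase_eq_zero {ℓ ℓ' : ℤ} (h : ℓ' + 1 = ℓ) {v : V} (x : CH K p ℓ)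
    (hx : ∀ I, v ∉ I.1 → x I = 0) (hdx : ∀ J, v ∉ J.1 → dPrime K p h x J = 0)
    (I : {I : Finset V // (I.card : ℤ) = ℓ}) :
    cohomologyMap (fullSubcomplex_mono K (I.1.erase_subset v)) p (x I) = 0 := by
  by_cases hv : v ∈ I.1
  · have hc := Finset.card_erase_add_one hv
    have hI := I.2
    have key := dPrime_apply_of_support K h x hx I ⟨I.1.erase v, by omega⟩
      (Finset.notMem_erase _ _) (Finset.insert_erase hv)
    rw [hdx _ (Finset.notMem_erase _ _)] at key
    rw [← mul_smul] at key
    rw [← one_smul ℤ (cohomologyMap _ p (x I)), ← sign_mul_self (p + 1) v I.1, mul_smul, ← key,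
      smul_zero]
  · rw [hx I hv, map_zero]

/-- Restrictions commute, so the elements dying on deletion of `v` form a subcomplex. Hence the
correction for `w` preserves the normalization for `r`. -/
theorem cohomologyMap_erase_dPrime {ℓ ℓ' : ℤ} (h : ℓ' + 1 = ℓ) {v : V} (x : CH K p ℓ)
    (hx : ∀ I, cohomologyMap (fullSubcomplex_mono K (I.1.erase_subset v)) p (x I) = 0)
    (J : {J : Finset V // (J.card : ℤ) = ℓ'}) :
    cohomologyMap (fullSubcomplex_mono K (J.1.erase_subset v)) p (dPrime K p h x J) = 0 := by
  have e : dPrime K p h x J = ((p + 1).negOnePow : ℤ) • ∑ i : {i : V // i ∉ J.1}, _ := rfl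
  rw [e, map_zsmul, map_sum, Finset.sum_eq_zero, smul_zero]
  intro i _
  rw [map_zsmul, cohomologyMap_erase_cohomologyMap K v (Finset.subset_insert i.1 J.1) _ (hx ⟨_, _⟩),
    smul_zero]

/-- On `I ∋ v`, `y` is a lift of the component of `x` at `I \ {v}`, up to sign. `S` carries a side
condition on the lifts: none for `r`, dying on deletion of `r` for `w`. -/
theorem exists_dPrime_eq_off {ℓ ℓ' : ℤ} (h : ℓ' + 1 = ℓ) {v : V} (x : CH K p ℓ')
    (S : (I : {I : Finset V // (I.card : ℤ) = ℓ}) →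
      AddSubgroup (Cohomology (fullSubcomplex K I.1) p))
    (hS : ∀ (J : {J : Finset V // (J.card : ℤ) = ℓ'}) (I : {I : Finset V // (I.card : ℤ) = ℓ})
      (hJI : J.1 ⊆ I.1), v ∉ J.1 → insert v J.1 = I.1 →
        ∃ y ∈ S I, cohomologyMap (fullSubcomplex_mono K hJI) p y = x J) :
    ∃ y : CH K p ℓ, (∀ I, v ∉ I.1 → y I = 0) ∧ (∀ I, y I ∈ S I) ∧
      ∀ J, v ∉ J.1 → dPrime K p h y J = x J := by
  have key : ∀ I : {I : Finset V // (I.card : ℤ) = ℓ}, ∃ y ∈ S I, (v ∉ I.1 → y = 0) ∧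
      ∀ (J : {J : Finset V // (J.card : ℤ) = ℓ'}) (hJI : J.1 ⊆ I.1), v ∉ J.1 →
        insert v J.1 = I.1 → cohomologyMap (fullSubcomplex_mono K hJI) p y =
          (((p + 1).negOnePow : ℤ) * ε v I.1) • x J := by
    intro I
    by_cases hv : v ∈ I.1
    · have hc := Finset.card_erase_add_one hv
      have hI := I.2
      have hJ₀ : ((I.1.erase v).card : ℤ) = ℓ' := by omega
      obtain ⟨y, hy, hyx⟩ := hS ⟨I.1.erase v, hJ₀⟩ I (Finset.erase_subset _ _)
        (Finset.notMem_erase _ _) (Finset.insert_erase hv)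
      refine ⟨(((p + 1).negOnePow : ℤ) * ε v I.1) • y, zsmul_mem hy _, fun h' => absurd hv h', ?_⟩
      intro J hJI hJ hins
      obtain rfl : J = ⟨I.1.erase v, hJ₀⟩ :=
        Subtype.ext (by simp only [← hins, Finset.erase_insert hJ])
      rw [map_zsmul, hyx]
    · exact ⟨0, zero_mem _, fun _ => rfl, fun J _ _ hins =>
        absurd (hins ▸ Finset.mem_insert_self _ _) hv⟩
  choose y hy hy0 hyx using key
  refine ⟨y, hy0, hy, fun J hJ => ?_⟩
  have hc := Finset.card_insert_of_notMem hJ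
  have hJ2 := J.2
  rw [dPrime_apply_of_support K h y hy0 ⟨insert v J.1, by omega⟩ J hJ rfl,
    hyx _ J (Finset.subset_insert v J.1) hJ rfl, ← mul_smul, ← mul_smul, sign_mul_self, one_smul]

variable {K}

theorem dPrime_dPrime {ℓ ℓ' ℓ'' : ℤ} (h : ℓ' + 1 = ℓ) (h' : ℓ'' + 1 = ℓ') (x : CH K p ℓ) :
    dPrime K p h' (dPrime K p h x) = 0 :=
  DFunLike.congr_fun (dPrime_comp_dPrime K p h h') x

/-- Only the components of `d' x` on sets missing `r` or `w` enter. This weaker form of the cocycle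
condition is needed to show that the generator on `{r, w}` has infinite order. -/
theorem IsStar.exists_normalized {r w : V} {τ : Finset V} (hK : IsStar K r τ) (hw : w ∉ τ)
    (hp : 0 ≤ p) {ℓ ℓ' ℓ'' : ℤ} (h : ℓ' + 1 = ℓ) (h' : ℓ'' + 1 = ℓ') (x : CH K p ℓ')
    (hx : ∀ J, r ∉ J.1 ∨ w ∉ J.1 → dPrime K p h' x J = 0) :
    ∃ y : CH K p ℓ, ∀ I,
      cohomologyMap (fullSubcomplex_mono K (I.1.erase_subset r)) p ((x - dPrime K p h y) I) = 0 ∧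
      cohomologyMap (fullSubcomplex_mono K (I.1.erase_subset w)) p
        ((x - dPrime K p h y) I) = 0 := by
  have hd : ∀ (x : CH K p ℓ') (y : CH K p ℓ),
      dPrime K p h' (x - dPrime K p h y) = dPrime K p h' x := fun x y => by
    rw [map_sub, dPrime_dPrime, sub_zero]
  obtain ⟨y₁, -, -, hy₁⟩ := exists_dPrime_eq_off K h (v := r) x (fun _ => ⊤)
    fun J I hJI hJ hins =>
      (hK.cohomologyMap_surjective hins hJ hp hJI (x J)).imp fun _ hy =>
        ⟨AddSubgroup.mem_top _, hy⟩
  set x₁ := x - dPrime K p h y₁ with hx₁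
  have hr : ∀ I, cohomologyMap (fullSubcomplex_mono K (I.1.erase_subset r)) p (x₁ I) = 0 :=
    cohomologyMap_erase_eq_zero K h' x₁
      (fun I hI => sub_eq_zero.2 (hy₁ I hI).symm)
      fun J hJ => by rw [hx₁, hd]; exact hx J (Or.inl hJ)
  obtain ⟨y₂, -, hy₂r, hy₂⟩ := exists_dPrime_eq_off K h (v := w) x₁
    (fun I => (cohomologyMap (fullSubcomplex_mono K (I.1.erase_subset r)) p).ker)
    fun J I hJI hJ hins => (hK.exists_lift hw hins hJI (x₁ J) (hr J)).imp fun _ hy =>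
      ⟨hy.2, hy.1⟩
  have e : x - dPrime K p h (y₁ + y₂) = x₁ - dPrime K p h y₂ := by
    rw [map_add, hx₁, sub_sub]
  refine ⟨y₁ + y₂, fun I => ?_⟩
  rw [e]
  constructor
  · rw [Pi.sub_apply, map_sub, hr, cohomologyMap_erase_dPrime K h y₂ hy₂r, sub_zero]
  · refine cohomologyMap_erase_eq_zero K h' (x₁ - dPrime K p h y₂)
      (fun I hI => sub_eq_zero.2 (hy₂ I hI).symm) ?_ I
    intro J hJ
    rw [hd, hx₁, hd]
    exact hx J (Or.inr hJ)

theorem IsStar.exists_dPrime_eq {r w : V} {τ : Finset V} (hK : IsStar K r τ) (hw : w ∉ τ)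
    (hp : 0 ≤ p) {ℓ ℓ' ℓ'' : ℤ} (h : ℓ' + 1 = ℓ) (h' : ℓ'' + 1 = ℓ') (hℓ : p ≠ 0 ∨ ℓ' ≠ 2)
    (x : CH K p ℓ') (hx : ∀ J, r ∉ J.1 ∨ w ∉ J.1 → dPrime K p h' x J = 0) :
    ∃ y : CH K p ℓ, dPrime K p h y = x := by
  obtain ⟨y, hy⟩ := hK.exists_normalized hw hp h h' x hx
  exact ⟨y, (sub_eq_zero.1 (hK.eq_zero_of_normalized hw hℓ _ hy)).symm⟩

end

/-! ## Double cohomology groups -/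

theorem subsingleton_HH {V : Type*} [Fintype V] [LinearOrder V]
    {K : PreAbstractSimplicialComplex V} {k ℓ : ℤ}
    (h : ∀ x, dPrime K (ℓ - k - 1) (sub_add_cancel ℓ 1) x = 0 →
      ∃ y, dPrime K (ℓ - k - 1) (rfl : ℓ + 1 = ℓ + 1) y = x) :
    Subsingleton (HH K k ℓ) := by
  refine ⟨fun a b => ?_⟩
  rw [← sub_eq_zero]
  obtain ⟨x, hx⟩ := QuotientAddGroup.mk_surjective (a - b)
  rw [← hx]
  exact (QuotientAddGroup.eq_zero_iff _).2 (AddSubgroup.mem_addSubgroupOf.2 (h x.1 x.2))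

theorem nonempty_HH_addEquiv {V : Type*} [Fintype V] [LinearOrder V]
    {K : PreAbstractSimplicialComplex V} {k ℓ : ℤ}
    (h : ∃ e, dPrime K (ℓ - k - 1) (sub_add_cancel ℓ 1) e = 0 ∧
      (∀ x, dPrime K (ℓ - k - 1) (sub_add_cancel ℓ 1) x = 0 →
        ∃ (c : ℤ) (y : _), dPrime K (ℓ - k - 1) (rfl : ℓ + 1 = ℓ + 1) y = x - c • e) ∧
      ∀ (c : ℤ) (y : _), dPrime K (ℓ - k - 1) (rfl : ℓ + 1 = ℓ + 1) y = c • e → c = 0) :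
    Nonempty (HH K k ℓ ≃+ ℤ) := by
  obtain ⟨e, he, hgen, hinj⟩ := h
  let e' : (dPrime K (ℓ - k - 1) (sub_add_cancel ℓ 1)).ker := ⟨e, he⟩
  let φ : ℤ →+ HH K k ℓ := zmultiplesHom _ (QuotientAddGroup.mk e')
  have hφ : ∀ c : ℤ, φ c = QuotientAddGroup.mk (c • e') := fun c => rfl
  refine ⟨(AddEquiv.ofBijective φ ⟨?_, fun a => ?_⟩).symm⟩
  · rw [injective_iff_map_eq_zero]
    intro c hc
    rw [hφ] at hc
    obtain ⟨y, hy⟩ := AddSubgroup.mem_addSubgroupOf.1 ((QuotientAddGroup.eq_zero_iff _).1 hc)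
    exact hinj c y hy
  · obtain ⟨x, rfl⟩ := QuotientAddGroup.mk_surjective a
    obtain ⟨c, y, hy⟩ := hgen x.1 x.2
    refine ⟨c, (hφ c).trans (sub_eq_zero.1 ?_).symm⟩
    exact (QuotientAddGroup.eq_zero_iff (x - c • e')).2
      (AddSubgroup.mem_addSubgroupOf.2 ⟨y, hy⟩)

theorem Face.subset {V : Type*} {K : PreAbstractSimplicialComplex V} {I : Finset V} {p : ℤ}
    (M : Face (fullSubcomplex K I) p) : M.1 ⊆ I := by
  rcases M.2.1 with h | h
  · rw [h]
    exact Finset.empty_subset I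
  · exact h.2

/-! ### Negative degrees -/

/-- A cocycle in degree -1 vanishes on `∅`, as its coboundary at any vertex `v ∈ I` shows; below -1
there are no faces. -/
theorem cohomology_eq_zero_of_neg {V : Type*} [LinearOrder V]
    {K : PreAbstractSimplicialComplex V} (hK : ∀ v, {v} ∈ K.faces) {I : Finset V} {p : ℤ}
    (hp : p < 0) (hI : p = -1 → I.Nonempty) (x : Cohomology (fullSubcomplex K I) p) : x = 0 := by
  obtain ⟨f, hf, rfl⟩ := exists_eq_cohomologyClass x
  refine (cohomologyClass_eq_zero_iff f hf).2 ⟨0, (map_zero _).trans (funext fun M => ?_)⟩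
  have hc := M.2.2
  obtain rfl : p = -1 := by omega
  obtain ⟨v, hv⟩ := hI rfl
  have hM : M.1 = ∅ := Finset.card_eq_zero.1 (by omega)
  obtain ⟨F, rfl, -⟩ := exists_eq_ofFun f
  have := congrFun hf ⟨{v}, Or.inr ⟨hK v, by simpa using hv⟩, by simp⟩
  rw [d_apply_of_singleton _ _ _ _ rfl] at this
  exact this.symm.trans (congrArg F hM.symm)

theorem eq_zero_of_neg {V : Type*} [LinearOrder V]
    {K : PreAbstractSimplicialComplex V} (hK : ∀ v, {v} ∈ K.faces) {p ℓ : ℤ}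
    (hp : p < 0) (hℓ : p = -1 → ℓ ≠ 0) (x : CH K p ℓ) : x = 0 :=
  funext fun I => cohomology_eq_zero_of_neg hK hp (fun h => Finset.card_pos.1 (by
    have := I.2
    have := hℓ h
    omega)) (x I)

theorem exists_generator_of_neg_one {V : Type*} [Fintype V] [LinearOrder V]
    {K : PreAbstractSimplicialComplex V} (hK : ∀ v, {v} ∈ K.faces) {p ℓ ℓ' ℓ'' : ℤ}
    (h : ℓ' + 1 = ℓ) (h' : ℓ'' + 1 = ℓ') (hp : p = -1) (hℓ : ℓ' = 0) :
    ∃ e, dPrime K p h' e = 0 ∧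
      (∀ x, dPrime K p h' x = 0 → ∃ (c : ℤ) (y : _), dPrime K p h y = x - c • e) ∧
      ∀ (c : ℤ) (y : _), dPrime K p h y = c • e → c = 0 := by
  subst hp hℓ
  have hM : ∀ I : {I : Finset V // (I.card : ℤ) = 0}, ∀ M : Face (fullSubcomplex K I.1) (-1 + 1),
      False := fun I M => by
    have h1 := M.2.2
    have h3 := Finset.card_le_card (Face.subset M)
    have h4 := I.2
    omega
  have hI₀ : ((∅ : Finset V).card : ℤ) = 0 := by simp
  refine ⟨fun I => cohomologyClass (ofFun _ (-1) fun _ => 1) (funext fun M => (hM I M).elim),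
    eq_zero_of_neg hK (by omega) (by omega) _, fun x _ => ?_, fun c y hy => ?_⟩
  · obtain ⟨f, hf, hx⟩ := exists_eq_cohomologyClass (x ⟨∅, hI₀⟩)
    refine ⟨f ⟨∅, Or.inl rfl, by simp⟩, 0, (map_zero _).trans (Eq.symm ?_)⟩
    funext I
    obtain rfl : I = ⟨∅, hI₀⟩ := Subtype.ext (Finset.card_eq_zero.1 (by exact_mod_cast I.2))
    refine sub_eq_zero.2 (hx.trans ?_)
    refine cohomologyClass_eq_of_sub_eq_d hf _ 0 ((map_zero _).trans (Eq.symm ?_))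
    rw [sub_eq_zero]
    funext M
    obtain rfl : M = ⟨∅, Or.inl rfl, by simp⟩ :=
      Subtype.ext (Finset.card_eq_zero.1 (by have := M.2.2; omega))
    exact (mul_one _).symm
  · rw [eq_zero_of_neg hK (by omega) (by omega) y, map_zero] at hy
    have h0 := (congrFun hy ⟨∅, hI₀⟩).symm
    obtain ⟨g, hg⟩ := (cohomologyClass_eq_zero_iff
      (c • ofFun (fullSubcomplex K ∅) (-1) fun _ => 1)
      (funext fun M => (hM ⟨∅, hI₀⟩ M).elim)).1 h0
    -- There are no faces of dimension -2.
    obtain rfl : g = 0 := funext fun M => absurd M.2.2 (by omega)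
    have := congrFun hg ⟨∅, Or.inl rfl, by simp⟩
    rw [map_zero] at this
    exact (this.trans (mul_one c)).symm

/-! ### Degree zero -/

theorem cohomology_zero_eq_zero_of_card_eq_one {V : Type*} [LinearOrder V]
    (K : PreAbstractSimplicialComplex V) {I : Finset V} (hI : I.card = 1)
    (x : Cohomology (fullSubcomplex K I) 0) : x = 0 := by
  obtain ⟨f, hf, rfl⟩ := exists_eq_cohomologyClass x
  obtain ⟨F, rfl, -⟩ := exists_eq_ofFun f
  refine (cohomologyClass_eq_zero_iff _ hf).2 ⟨ofFun _ _ fun _ => F I, funext fun M => ?_⟩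
  have hc : M.1.card = 1 := by have := M.2.2; omega
  have hM : M.1 = I := Finset.eq_of_subset_of_card_le (Face.subset M) (by omega)
  obtain ⟨v, hv⟩ := Finset.card_eq_one.1 hc
  rw [d_apply_of_singleton _ _ _ _ hv]
  exact congrArg F hM.symm

/-- The class in degree zero of `c` times the indicator function of the isolated vertex `r`. -/
def IsStar.single {V : Type*} [LinearOrder V] {K : PreAbstractSimplicialComplex V} {r : V}
    {τ I : Finset V} (hK : IsStar K r τ) (hI : Disjoint (I.erase r) τ) (c : ℤ) :
    Cohomology (fullSubcomplex K I) 0 :=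
  cohomologyClass (ofFun _ 0 fun M => if M = {r} then c else 0) (hK.d_single_eq_zero hI rfl c)

theorem IsStar.single_eq_smul {V : Type*} [LinearOrder V] {K : PreAbstractSimplicialComplex V}
    {r : V} {τ I : Finset V} (hK : IsStar K r τ) (hI : Disjoint (I.erase r) τ) (c : ℤ) :
    hK.single hI c = c • hK.single hI 1 := by
  refine cohomologyClass_eq_of_sub_eq_d (f' := c • ofFun _ 0 fun M => if M = {r} then 1 else 0)
    _ (by rw [map_zsmul, hK.d_single_eq_zero hI rfl, smul_zero]) 0
    ((map_zero _).trans (sub_eq_zero.2 (funext fun M => ?_)).symm)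
  simp [ofFun]

/-- The generator is the indicator of `r` on the two isolated points `{r, w}`; normalization reduces
every cocycle to a multiple of it. -/
theorem IsStar.exists_generator {V : Type*} [Fintype V] [LinearOrder V]
    {K : PreAbstractSimplicialComplex V} {r w : V} {τ : Finset V} (hK : IsStar K r τ)
    (hw : w ∉ τ) {p ℓ ℓ' ℓ'' : ℤ} (h : ℓ' + 1 = ℓ) (h' : ℓ'' + 1 = ℓ') (hp : p = 0)
    (hℓ : ℓ' = 2) :
    ∃ e, dPrime K p h' e = 0 ∧
      (∀ x, dPrime K p h' x = 0 → ∃ (c : ℤ) (y : _), dPrime K p h y = x - c • e) ∧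
      ∀ (c : ℤ) (y : _), dPrime K p h y = c • e → c = 0 := by
  subst hp hℓ
  have hwr : w ≠ r := fun e => hw (e ▸ hK.mem)
  have hI : ∀ I : Finset V, I = {r, w} → Disjoint (I.erase r) τ := by
    rintro I rfl
    rw [Finset.disjoint_left]
    intro a ha haτ
    rw [Finset.mem_erase, Finset.mem_insert, Finset.mem_singleton] at ha
    exact hw (ha.2.resolve_left ha.1 ▸ haτ)
  have hI₀ : ((({r, w} : Finset V)).card : ℤ) = 2 := by rw [Finset.card_pair hwr.symm]; rfl
  set e : CH K 0 2 := fun I => if h : I.1 = {r, w} then hK.single (hI I.1 h) 1 else 0 with he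
  have he₀ : e ⟨{r, w}, hI₀⟩ = hK.single (hI _ rfl) 1 := dif_pos rfl
  have he₁ : ∀ I, I.1 ≠ {r, w} → e I = 0 := fun I h => dif_neg h
  refine ⟨e, ?_, fun x hx => ?_, fun c y hy => ?_⟩
  · exact funext fun J =>
      cohomology_zero_eq_zero_of_card_eq_one K (by have := J.2; omega) _
  · obtain ⟨y, hy⟩ := hK.exists_normalized hw le_rfl h h' x
      fun J _ => congrFun hx J
    have hc : ∃ c : ℤ, (x - dPrime K 0 h y) ⟨{r, w}, hI₀⟩ = c • e ⟨{r, w}, hI₀⟩ := by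
      rw [he₀]
      rcases hK.eq_zero_or (Finset.erase_subset r {r, w}) _ (hy ⟨{r, w}, hI₀⟩).1 with h0 | ⟨-, -, c, hc, h0⟩
      · exact ⟨0, h0.trans (zero_smul _ _).symm⟩
      · exact ⟨c, h0.trans (hK.single_eq_smul (hI _ rfl) c)⟩
    obtain ⟨c, hc⟩ := hc
    refine ⟨c, y, ?_⟩
    rw [eq_sub_iff_add_eq, add_comm, ← eq_sub_iff_add_eq]
    funext I
    by_cases hIe : I.1 = {r, w}
    · obtain rfl : I = ⟨{r, w}, hI₀⟩ := Subtype.ext hIe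
      exact hc.symm
    · refine ((congrArg (c • ·) (he₁ I hIe)).trans (smul_zero c)).trans (Eq.symm ?_)
      have hnot : r ∉ I.1 ∨ w ∉ I.1 := by
        by_contra! hcon
        refine hIe (Finset.eq_of_subset_of_card_le ?_ ?_).symm
        · exact Finset.insert_subset hcon.1 (Finset.singleton_subset_iff.2 hcon.2)
        · have := I.2
          omega
      rcases hnot with hr | hr
      · exact eq_zero_of_cohomologyMap_erase_of_notMem K hr _ (hy I).1
      · exact eq_zero_of_cohomologyMap_erase_of_notMem K hr _ (hy I).2
  -- As `c • e` lives on `{r, w}` only, `d' y` vanishes on all sets missing `r` or `w`. One level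
  -- up, at size 3, this already makes `y` a boundary, so `c • e = d' y = 0`.
  · obtain ⟨z, rfl⟩ := hK.exists_dPrime_eq hw le_rfl rfl h (Or.inr (by omega)) y fun J hJ => by
      rw [hy]
      refine (congrArg (c • ·) (he₁ J fun e' => ?_)).trans (smul_zero c)
      rw [e'] at hJ
      simp at hJ
    rw [dPrime_dPrime] at hy
    have h0 := congrFun hy.symm ⟨{r, w}, hI₀⟩
    replace h0 : c • e ⟨{r, w}, hI₀⟩ = 0 := h0
    rw [he₀, ← hK.single_eq_smul] at h0
    exact hK.eq_zero_of_single_eq_zero (Finset.mem_insert_self _ _) (by simp) hwr _ h0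

/-! ### From the gluing to a vertex with simplicial star, and the theorem -/

theorem IsGluing.isStar {V : Type*} {K K' : PreAbstractSimplicialComplex V} {n : ℕ}
    {σ τ : Finset V} (hK : IsGluing K K' n σ τ) (hv : ∀ v, {v} ∈ K.faces) {r : V} (hr : r ∈ τ)
    (hrσ : r ∉ σ) : IsStar K r τ := by
  have hmem : ∀ L, L ∈ K.faces ↔ L ∈ K'.faces ∨ L.Nonempty ∧ L ⊆ τ := fun L => by
    rw [hK.union_eq]
    rfl
  refine ⟨hr, fun L hL hrL => ?_, fun L hL hLτ => (hmem L).2 (Or.inr ⟨hL, hLτ⟩), hv⟩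
  -- A simplex of `K'` containing `r` would put `{r}` into the intersection, hence `r` into `σ`.
  refine ((hmem L).1 hL).elim (fun hL' => absurd ?_ hrσ) And.right
  have h1 : ({r} : Finset V) ∈ (K' ⊓ simplex τ).faces :=
    ⟨(K'.isRelLowerSet_faces hL').2 (Finset.singleton_subset_iff.2 hrL)
      (Finset.singleton_nonempty r), Finset.singleton_nonempty r,
      Finset.singleton_subset_iff.2 hr⟩
  rw [hK.inter_eq] at h1
  exact Finset.singleton_subset_iff.1 h1.2

end MomentAngle

theorem theorem6p6 {V : Type*} [Fintype V] [LinearOrder V]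
    (K : AbstractSimplicialComplex V) (K' : PreAbstractSimplicialComplex V)
    (n : ℕ) (σ τ : Finset V) (hK' : K'.faces.Nonempty)
    (hK : MomentAngle.IsGluing K.toPreAbstractSimplicialComplex K' n σ τ) :
    K.toPreAbstractSimplicialComplex = MomentAngle.simplex Finset.univ ∨
      ∀ k ℓ : ℤ,
        (((-k, 2 * ℓ) = ((0 : ℤ), (0 : ℤ)) ∨ (-k, 2 * ℓ) = ((-1 : ℤ), (4 : ℤ))) →
          Nonempty (MomentAngle.HH K.toPreAbstractSimplicialComplex k ℓ ≃+ ℤ)) ∧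
        (¬((-k, 2 * ℓ) = ((0 : ℤ), (0 : ℤ)) ∨ (-k, 2 * ℓ) = ((-1 : ℤ), (4 : ℤ))) →
          Subsingleton (MomentAngle.HH K.toPreAbstractSimplicialComplex k ℓ)) := by
  obtain ⟨r, hr, hrσ⟩ := Finset.exists_of_ssubset hK.proper
  have hstar := hK.isStar K.singleton_mem hr hrσ
  by_cases hτ : τ = Finset.univ
  · left
    ext L
    exact ⟨fun hL => ⟨(K.isRelLowerSet_faces hL).1, Finset.subset_univ L⟩,
      fun hL => hstar.mem_faces L hL.1 (hτ ▸ hL.2)⟩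
  right
  obtain ⟨w, hw⟩ : ∃ w, w ∉ τ := by
    by_contra! h
    exact hτ (Finset.eq_univ_of_forall h)
  intro k ℓ
  simp only [Prod.mk.injEq]
  constructor
  · rintro (⟨hk, hℓ⟩ | ⟨hk, hℓ⟩)
    · exact MomentAngle.nonempty_HH_addEquiv
        (MomentAngle.exists_generator_of_neg_one hstar.singleton _ _ (by omega) (by omega))
    · exact MomentAngle.nonempty_HH_addEquiv
        (hstar.exists_generator hw _ _ (by omega) (by omega))
  · intro h
    refine MomentAngle.subsingleton_HH fun x hx => ?_
    -- The two excluded bidegrees are `p = -1, ℓ = 0` and `p = 0, ℓ = 2`.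
    rcases lt_or_ge (ℓ - k - 1) 0 with hp | hp
    · exact ⟨0, (map_zero _).trans
        (MomentAngle.eq_zero_of_neg hstar.singleton hp (by omega) x).symm⟩
    · exact hstar.exists_dPrime_eq hw hp _ _ (by omega) x fun J _ => congrFun hx J
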